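/- Let $M$ be a (connected) complete $n$-dimensional smooth Riemannian manifold with distance function $\rho$, and write $B_x(r)=\{y\in M:\rho(x,y)<r\}$. Let $i(x)\in(0,+\infty]$ be the injectivity radius at $x$, i.e. the supremum of all $r>0$ for which $\exp_x$ is a diffeomorphism from $\{v\in T_xM:|v|<r\}$ onto $B_x(r)$. Let $x^*\in M$, let $D\subseteq B_{x^*}(i(x^*))$ be an open set containing $x^*$, and let $f(t,\cdot)$, $t\ge 0$, be a time-dependent vector field on $D$ that is continuous in $t$ and locally Lipschitz in $x$ (in charts, with a Lipschitz constant that is locally uniform in $t$), with $f(t,x^*)=0$ for all $t\ge 0$. Consider the system $$\dot x(t)=f(t,x(t)),\qquad t\ge t_0\ge 0,$$ whose solutions take values in $D$. Put $r_0=\sup\{r>0: B_{x^*}(r)\subseteq D\}\in(0,+\infty]$. Suppose that there are positive constants $k_1,k_2,k_3,a$ and a continuously differentiable function $V:[0,+\infty)\times D\to\mathbb R$ such that for all $(t,x)\in[0,+\infty)\times D$ $$k_1\,\rho(x^*,x)^a\le V(t,x)\le k_2\,\rho(x^*,x)^a,\qquad V_t(t,x)+d_xV(t,x)\big(f(t,x)\big)\le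 -k_3\,\rho(x^*,x)^a .$$ Let $B=B_{x^*}\big((k_1/k_2)^{1/a}r_0\big)$, which means $B=M$ if $r_0=+\infty$. Then $x^*$ is exponentially stable in $B$: $B\subseteq D$, for every $t_0\ge 0$ and $x_0\in B$ the system has a solution on $[t_0,+\infty)$ with $x(t_0)=x_0$, and there are constants $k,\lambda>0$, independent of $t_0$ and $x_0$, with $\rho(x^*,x(t))\le k\,\rho(x^*,x(t_0))\,e^{-\lambda(t-t_0)}$ for every such solution and all $t\ge t_0$. Explicitly, every solution on $[t_0,+\infty)$, $t_0\ge 0$, with $x(t_0)\in B$ satisfies $$\rho(x(t),x^*)\le\Big(\frac{k_2}{k_1}\Big)^{1/a}\rho(x(t_0),x^*)\,e^{-\frac{k_3}{a k_2}(t-t_0)},\qquad t\ge t_0 .$$ -/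

import Mathlib

open Set Bundle Manifold Topology
open scoped ContDiff ENNReal NNReal

noncomputable section

namespace LyapunovManifold

variable {n : ℕ} {M : Type*}

section Geodesics

variable [MetricSpace M] [ChartedSpace (EuclideanSpace ℝ (Fin n)) M]
  [RiemannianBundle (fun x : M => TangentSpace (𝓡 n) x)]

/-- The metric tensor `g_p(v, w)` in the coordinates given by the chart at `c`. -/
def chartMetric (c : M) (p v w : EuclideanSpace ℝ (Fin n)) : ℝ :=
  inner ℝ
    (mfderiv 𝓘(ℝ, EuclideanSpace ℝ (Fin n)) (𝓡 n) (extChartAt (𝓡 n) c).symm p v)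
    (mfderiv 𝓘(ℝ, EuclideanSpace ℝ (Fin n)) (𝓡 n) (extChartAt (𝓡 n) c).symm p w)

/-- The Christoffel symbols of the first kind of the Levi-Civita connection in the chart at `c`,
`Γ(v₁, v₂; w) = (∂_{v₁} g(v₂, w) + ∂_{v₂} g(v₁, w) - ∂_w g(v₁, v₂)) / 2`. -/
def christoffel (c : M) (p v₁ v₂ w : EuclideanSpace ℝ (Fin n)) : ℝ :=
  (fderiv ℝ (fun q => chartMetric c q v₂ w) p v₁
    + fderiv ℝ (fun q => chartMetric c q v₁ w) p v₂
    - fderiv ℝ (fun q => chartMetric c q v₁ v₂) p w) / 2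

variable (n) in
/-- A geodesic `γ : ℝ → M`: a smooth curve with `∇_{γ'} γ' = 0`. At time `t` the equation is
written in the chart at `γ t`, with the coordinate curve `u = φ ∘ γ`, and it is paired with an
arbitrary vector `w`: `g(u'', w) + Γ(u', u'; w) = 0`. -/
def IsGeodesic (γ : ℝ → M) : Prop :=
  ContMDiff 𝓘(ℝ, ℝ) (𝓡 n) ∞ γ ∧
    ∀ (t : ℝ) (w : EuclideanSpace ℝ (Fin n)),
      let u : ℝ → EuclideanSpace ℝ (Fin n) := fun s => extChartAt (𝓡 n) (γ t) (γ s)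
      chartMetric (γ t) (u t) (deriv (deriv u) t) w
        + christoffel (γ t) (u t) (deriv u t) (deriv u t) w = 0

open Classical in
/-- The exponential map `exp_x v = γ 1`, where `γ` is the geodesic with `γ 0 = x`, `γ' 0 = v`.
On a complete manifold this geodesic exists for every `v`, and it is unique. -/
def riemannianExp (x : M) (v : TangentSpace (𝓡 n) x) : M :=
  if h : ∃ γ : ℝ → M, IsGeodesic n γ ∧
      (⟨γ 0, mfderiv 𝓘(ℝ, ℝ) (𝓡 n) γ 0 (1 : ℝ)⟩ : TangentBundle (𝓡 n) M) = ⟨x, v⟩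
  then h.choose 1 else x

variable (n) in
/-- `exp_x` restricts to a diffeomorphism from `{v ∈ T_x M : |v| < r}` onto the geodesic ball
`B_x(r)`. -/
def ExpIsDiffeoOnBall (x : M) (r : ℝ) : Prop :=
  ∃ Φ : PartialDiffeomorph 𝓘(ℝ, TangentSpace (𝓡 n) x) (𝓡 n) (TangentSpace (𝓡 n) x) M ∞,
    Φ.source = {v : TangentSpace (𝓡 n) x | ‖v‖ < r} ∧ Φ.target = Metric.ball x r ∧
      ∀ v ∈ Φ.source, Φ v = riemannianExp x v

variable (n) in
/-- The injectivity radius `i(x) ∈ [0, ∞]`. -/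
def injectivityRadius (x : M) : ℝ≥0∞ :=
  sSup {R : ℝ≥0∞ | ∃ r : ℝ, 0 < r ∧ R = ENNReal.ofReal r ∧ ExpIsDiffeoOnBall n x r}

end Geodesics

/-- `r₀ = sup {r > 0 : B_x(r) ⊆ D} ∈ [0, ∞]`. -/
def inradius [MetricSpace M] (x : M) (D : Set M) : ℝ≥0∞ :=
  sSup {R : ℝ≥0∞ | ∃ r : ℝ, 0 < r ∧ R = ENNReal.ofReal r ∧ Metric.ball x r ⊆ D}

section System

variable [MetricSpace M] [ChartedSpace (EuclideanSpace ℝ (Fin n)) M]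

/-- The time-dependent vector field `f` in the coordinates of the chart `φ` at `c`:
`F(t, u) = dφ_p (f(t, p))` with `p = φ⁻¹(u)`. -/
def chartField (f : ℝ → (x : M) → TangentSpace (𝓡 n) x) (c : M)
    (t : ℝ) (u : EuclideanSpace ℝ (Fin n)) : EuclideanSpace ℝ (Fin n) :=
  mfderiv (𝓡 n) 𝓘(ℝ, EuclideanSpace ℝ (Fin n)) (extChartAt (𝓡 n) c)
    ((extChartAt (𝓡 n) c).symm u) (f t ((extChartAt (𝓡 n) c).symm u))

/-- `f` is continuous in `t` and locally Lipschitz in `x` on `[0, ∞) × D`. As usual for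
time-dependent vector fields, near each `(t₀, c)` one Lipschitz constant serves all times
close to `t₀`. -/
structure IsRegularField (f : ℝ → (x : M) → TangentSpace (𝓡 n) x) (D : Set M) : Prop where
  continuous_time : ∀ x ∈ D, ContinuousOn (fun t => f t x) (Ici 0)
  locally_lipschitz : ∀ t₀ : ℝ, 0 ≤ t₀ → ∀ c ∈ D,
    ∃ J ∈ 𝓝[Ici 0] t₀, ∃ U ∈ 𝓝 (extChartAt (𝓡 n) c c), ∃ L : ℝ≥0,
      ∀ t ∈ J, LipschitzOnWith L (chartField f c t) U

/-- `x` is an equilibrium point of `x' = f(t, x)` on `[0, ∞) × D`. -/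
def IsEquilibrium (f : ℝ → (x : M) → TangentSpace (𝓡 n) x) (D : Set M) (x : M) : Prop :=
  x ∈ D ∧ ∀ t : ℝ, 0 ≤ t → f t x = 0

/-- `x` is a solution on `[t₀, ∞)` of `x'(t) = f(t, x(t))`, `x(t₀) = x₀`, with values in `D`
(one-sided derivative at `t₀`). -/
structure IsSolution (f : ℝ → (x : M) → TangentSpace (𝓡 n) x) (D : Set M)
    (t₀ : ℝ) (x₀ : M) (x : ℝ → M) : Prop where
  initial : x t₀ = x₀
  mem : ∀ t : ℝ, t₀ ≤ t → x t ∈ D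
  hasDeriv : ∀ t : ℝ, t₀ ≤ t → HasMFDerivWithinAt 𝓘(ℝ, ℝ) (𝓡 n) x (Ici t₀) t
    ((1 : ℝ →L[ℝ] ℝ).smulRight (f t (x t)))

/-- The derivative `V_t(t, x) + d_x V(t, x) (f(t, x))` of `V` along the system (`V_t` is one-sided
at `t = 0`). -/
def orbitalDeriv (f : ℝ → (x : M) → TangentSpace (𝓡 n) x) (V : ℝ → M → ℝ) (t : ℝ) (x : M) : ℝ :=
  derivWithin (fun s => V s x) (Ici 0) t
    + (show ℝ from mfderiv (𝓡 n) 𝓘(ℝ, ℝ) (V t) x (f t x))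

/-- The equilibrium `xs` is exponentially stable in `S ⊆ D`: for all `t₀ ≥ 0` and `x₀ ∈ S` the
solution from `(t₀, x₀)` exists on `[t₀, ∞)`, and it decays exponentially with constants that
depend on neither `t₀` nor `x₀`. -/
def IsExponentiallyStableIn (f : ℝ → (x : M) → TangentSpace (𝓡 n) x) (D : Set M)
    (xs : M) (S : Set M) : Prop :=
  IsEquilibrium f D xs ∧ S ⊆ D ∧
    ∃ k > (0 : ℝ), ∃ lam > (0 : ℝ), ∀ t₀ : ℝ, 0 ≤ t₀ → ∀ x₀ ∈ S,
      (∃ x : ℝ → M, IsSolution f D t₀ x₀ x) ∧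
      ∀ x : ℝ → M, IsSolution f D t₀ x₀ x → ∀ t : ℝ, t₀ ≤ t →
        dist xs (x t) ≤ k * dist xs (x t₀) * Real.exp (-lam * (t - t₀))

end System

end LyapunovManifold

end

namespace LyapunovManifold

/-- Hopf–Rinow for complete locally compact length spaces: closed balls are compact. -/
theorem properSpace_of_exists_between {M : Type*} [MetricSpace M] [CompleteSpace M]
    [LocallyCompactSpace M]
    (h : ∀ (x y : M) (r s : ℝ), 0 ≤ r → 0 < s → dist x y < r + s →
      ∃ z, dist x z ≤ r ∧ dist z y < s) : ProperSpace M := by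
  refine ⟨fun x => ?_⟩
  by_contra! hcon
  obtain ⟨r₁, hr₁⟩ := hcon
  set S : Set ℝ := {r | 0 ≤ r ∧ IsCompact (Metric.closedBall x r)} with hS
  have h0 : (0 : ℝ) ∈ S := ⟨le_rfl, by simp⟩
  have hbdd : BddAbove S := by
    refine ⟨r₁, fun r hr => ?_⟩
    by_contra! hlt
    exact hr₁ (hr.2.of_isClosed_subset Metric.isClosed_closedBall
      (Metric.closedBall_subset_closedBall hlt.le))
  have hR0 : 0 ≤ sSup S := le_csSup hbdd h0
  have hRc : IsCompact (Metric.closedBall x (sSup S)) := by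
    refine isCompact_iff_totallyBounded_isComplete.2
      ⟨?_, Metric.isClosed_closedBall.isComplete⟩
    refine Metric.totallyBounded_iff.2 fun ε hε => ?_
    obtain ⟨r, hr, hlt⟩ := exists_lt_of_lt_csSup ⟨0, h0⟩
      (show sSup S - ε / 2 < sSup S by linarith)
    obtain ⟨t, ht, hcov⟩ := Metric.totallyBounded_iff.1 hr.2.totallyBounded (ε / 2) (by linarith)
    refine ⟨t, ht, fun y hy => ?_⟩
    rw [Metric.mem_closedBall'] at hy
    obtain ⟨z, hz, hzy⟩ := h x y r (ε / 2) hr.1 (by linarith) (by linarith)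
    have hzmem := hcov (Metric.mem_closedBall'.2 hz)
    simp only [mem_iUnion, Metric.mem_ball, exists_prop] at hzmem ⊢
    obtain ⟨w, hw, hzw⟩ := hzmem
    refine ⟨w, hw, ?_⟩
    have := dist_triangle y z w
    rw [dist_comm y z] at this
    linarith
  obtain ⟨δ, hδ, hδc⟩ := hRc.exists_isCompact_cthickening
  have hmem : sSup S + δ / 2 ∈ S := by
    refine ⟨by linarith, hδc.of_isClosed_subset Metric.isClosed_closedBall fun y hy => ?_⟩
    rw [Metric.mem_closedBall'] at hy
    obtain ⟨z, hz, hzy⟩ := h x y (sSup S) δ hR0 hδ (by linarith)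
    exact Metric.mem_cthickening_of_dist_le y z δ _ (Metric.mem_closedBall'.2 hz)
      (by rw [dist_comm]; exact hzy.le)
  linarith [le_csSup hbdd hmem]

theorem exists_contMDiffOn_pathELength_lt (n : ℕ) {M : Type*} [MetricSpace M]
    [ChartedSpace (EuclideanSpace ℝ (Fin n)) M]
    [RiemannianBundle (fun x : M => TangentSpace (𝓡 n) x)] [IsRiemannianManifold (𝓡 n) M]
    {x y : M} {r : ℝ} (h : dist x y < r) :
    ∃ γ : ℝ → M, γ 0 = x ∧ γ 1 = y ∧ ContMDiffOn 𝓘(ℝ, ℝ) (𝓡 n) 1 γ (Icc 0 1) ∧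
      pathELength (𝓡 n) γ 0 1 < ENNReal.ofReal r := by
  apply exists_lt_of_riemannianEDist_lt
  rw [← IsRiemannianManifold.out (I := 𝓡 n), edist_dist]
  exact (ENNReal.ofReal_lt_ofReal_iff (dist_nonneg.trans_lt h)).2 h

theorem exists_between_of_dist_lt (n : ℕ) {M : Type*} [MetricSpace M]
    [ChartedSpace (EuclideanSpace ℝ (Fin n)) M]
    [RiemannianBundle (fun x : M => TangentSpace (𝓡 n) x)] [IsRiemannianManifold (𝓡 n) M]
    (x y : M) (r s : ℝ) (hr : 0 ≤ r) (hs : 0 < s)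
    (h : dist x y < r + s) : ∃ z, dist x z ≤ r ∧ dist z y < s := by
  rcases le_or_gt (dist x y) r with hle | hlt
  · exact ⟨y, hle, by simpa using hs⟩
  obtain ⟨γ, h0, h1, hγ, hlen⟩ := exists_contMDiffOn_pathELength_lt n h
  have hcont : ContinuousOn (fun t => dist x (γ t)) (Icc 0 1) :=
    (continuous_const.dist continuous_id).comp_continuousOn hγ.continuousOn
  obtain ⟨t, ht, htr⟩ := intermediate_value_Icc zero_le_one hcont
    (show r ∈ Icc (dist x (γ 0)) (dist x (γ 1)) by simp [h0, h1, hr, hlt.le])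
  refine ⟨γ t, htr.le, ?_⟩
  have e1 : edist x (γ t) ≤ pathELength (𝓡 n) γ 0 t := by
    rw [IsRiemannianManifold.out (I := 𝓡 n)]
    exact riemannianEDist_le_pathELength (hγ.mono (Icc_subset_Icc_right ht.2)) h0 rfl ht.1
  have e2 : edist (γ t) y ≤ pathELength (𝓡 n) γ t 1 := by
    rw [IsRiemannianManifold.out (I := 𝓡 n)]
    exact riemannianEDist_le_pathELength (hγ.mono (Icc_subset_Icc_left ht.1)) rfl h1 ht.2
  have e3 : edist x (γ t) + edist (γ t) y < ENNReal.ofReal (r + s) :=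
    (add_le_add e1 e2).trans_lt (by rwa [pathELength_add ht.1 ht.2])
  rw [edist_dist, edist_dist, ← ENNReal.ofReal_add dist_nonneg dist_nonneg,
    ENNReal.ofReal_lt_ofReal_iff (by linarith)] at e3
  simp only at htr
  linarith

theorem preconnectedSpace_of_isRiemannianManifold (n : ℕ) (M : Type*) [MetricSpace M]
    [ChartedSpace (EuclideanSpace ℝ (Fin n)) M]
    [RiemannianBundle (fun x : M => TangentSpace (𝓡 n) x)] [IsRiemannianManifold (𝓡 n) M]
    : PreconnectedSpace M := by
  refine ⟨isPreconnected_of_forall_pair fun x _ y _ => ?_⟩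
  obtain ⟨γ, h0, h1, hγ, -⟩ := exists_contMDiffOn_pathELength_lt n (lt_add_one (dist x y))
  exact ⟨γ '' Icc 0 1, subset_univ _, ⟨0, by simp, h0⟩, ⟨1, by simp, h1⟩,
    isPreconnected_Icc.image γ hγ.continuousOn⟩

theorem properSpace_of_isRiemannianManifold (n : ℕ) (M : Type*) [MetricSpace M]
    [ChartedSpace (EuclideanSpace ℝ (Fin n)) M]
    [RiemannianBundle (fun x : M => TangentSpace (𝓡 n) x)] [IsRiemannianManifold (𝓡 n) M]
    [CompleteSpace M] : ProperSpace M := by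
  have : LocallyCompactSpace M := Manifold.locallyCompact_of_finiteDimensional (𝓡 n)
  exact properSpace_of_exists_between (exists_between_of_dist_lt n)

/-- The Picard–Lindelöf theorem, with the information that the solution stays in the ball on which
the vector field is controlled. -/
theorem exists_forall_mem_Icc_hasDerivWithinAt_mem_closedBall {E : Type*} [NormedAddCommGroup E]
    [NormedSpace ℝ E] [CompleteSpace E] {F : ℝ → E → E} {tmin tmax : ℝ} {t₀ : Icc tmin tmax}
    {x₀ : E} {a L K : ℝ≥0} (hF : IsPicardLindelof F t₀ x₀ a 0 L K) :
    ∃ α : ℝ → E, α t₀ = x₀ ∧ (∀ t, α t ∈ Metric.closedBall x₀ a) ∧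
      ∀ t ∈ Icc tmin tmax, HasDerivWithinAt α (F t (α t)) (Icc tmin tmax) t := by
  have hx : x₀ ∈ Metric.closedBall x₀ ((0 : ℝ≥0) : ℝ) := Metric.mem_closedBall_self le_rfl
  obtain ⟨α, hα⟩ := ODE.FunSpace.exists_isFixedPt_next hF hx
  refine ⟨α.compProj, by rw [ODE.FunSpace.compProj_val, α.apply_of_zero],
    fun t => α.compProj_mem_closedBall hF.mul_max_le, fun t ht => ?_⟩
  apply ODE.hasDerivWithinAt_picard_Icc t₀.2 hF.continuousOn_uncurry
    α.continuous_compProj.continuousOn (fun _ _ => α.compProj_mem_closedBall hF.mul_max_le)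
    x₀ ht |>.congr_of_mem _ ht
  intro t' ht'
  nth_rw 1 [← hα]
  rw [ODE.FunSpace.compProj_of_mem ht', ODE.FunSpace.next_apply]

section Flow

variable {n : ℕ} {M : Type*} [MetricSpace M] [ChartedSpace (EuclideanSpace ℝ (Fin n)) M]
  {f : ℝ → (x : M) → TangentSpace (𝓡 n) x} {D : Set M}

/-- `x` solves `x' = f(t, x)` on the set `I` of times, with values in `D`. -/
def IsSolutionOn (f : ℝ → (x : M) → TangentSpace (𝓡 n) x) (D : Set M) (I : Set ℝ)
    (x : ℝ → M) : Prop :=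
  ∀ t ∈ I, x t ∈ D ∧ HasMFDerivWithinAt 𝓘(ℝ, ℝ) (𝓡 n) x I t
    ((1 : ℝ →L[ℝ] ℝ).smulRight (f t (x t)))

theorem IsSolutionOn.mono {I J : Set ℝ} {x : ℝ → M} (h : IsSolutionOn f D I x) (hJ : J ⊆ I) :
    IsSolutionOn f D J x :=
  fun t ht => ⟨(h t (hJ ht)).1, (h t (hJ ht)).2.mono hJ⟩

theorem IsSolution.isSolutionOn {t₀ : ℝ} {x₀ : M} {x : ℝ → M} (h : IsSolution f D t₀ x₀ x) :
    IsSolutionOn f D (Ici t₀) x :=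
  fun t ht => ⟨h.mem t ht, h.hasDeriv t ht⟩

theorem hasMFDerivWithinAt_smulRight_congr {I : Set ℝ} {x z : ℝ → M} {t : ℝ}
    (h : HasMFDerivWithinAt 𝓘(ℝ, ℝ) (𝓡 n) x I t ((1 : ℝ →L[ℝ] ℝ).smulRight (f t (x t))))
    (hz : z =ᶠ[𝓝[I] t] x) (ht : z t = x t) :
    HasMFDerivWithinAt 𝓘(ℝ, ℝ) (𝓡 n) z I t ((1 : ℝ →L[ℝ] ℝ).smulRight (f t (z t))) := by
  have h2 := h.congr_of_eventuallyEq hz ht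
  have key : ∀ p q : M, p = q →
      ((1 : ℝ →L[ℝ] ℝ).smulRight (show EuclideanSpace ℝ (Fin n) from f t p)) =
      ((1 : ℝ →L[ℝ] ℝ).smulRight (show EuclideanSpace ℝ (Fin n) from f t q)) := by
    rintro p q rfl; rfl
  exact h2.congr_mfderiv (key _ _ ht.symm)

theorem IsSolutionOn.congr {I : Set ℝ} {x z : ℝ → M} (h : IsSolutionOn f D I x)
    (hz : EqOn z x I) : IsSolutionOn f D I z := fun t ht => by
  refine ⟨by rw [hz ht]; exact (h t ht).1, ?_⟩
  exact hasMFDerivWithinAt_smulRight_congr (h t ht).2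
    (Filter.eventuallyEq_of_mem self_mem_nhdsWithin hz) (hz ht)

theorem IsSolutionOn.union_Icc {a b c : ℝ} {x : ℝ → M}
    (hab : IsSolutionOn f D (Icc a b) x) (hbc : IsSolutionOn f D (Icc b c) x)
    (h1 : a ≤ b) (h2 : b ≤ c) : IsSolutionOn f D (Icc a c) x := by
  intro t ht
  rcases lt_trichotomy t b with h | h | h
  · refine ⟨(hab t ⟨ht.1, h.le⟩).1, (hab t ⟨ht.1, h.le⟩).2.mono_of_mem_nhdsWithin ?_⟩
    filter_upwards [self_mem_nhdsWithin, mem_nhdsWithin_of_mem_nhds (Iio_mem_nhds h)] with s hs hs'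
    exact ⟨hs.1, le_of_lt hs'⟩
  · subst h
    have := (hab t ⟨ht.1, le_rfl⟩).2.union (hbc t ⟨le_rfl, ht.2⟩).2
    rw [Icc_union_Icc_eq_Icc h1 h2] at this
    exact ⟨(hab t ⟨ht.1, le_rfl⟩).1, this⟩
  · refine ⟨(hbc t ⟨h.le, ht.2⟩).1, (hbc t ⟨h.le, ht.2⟩).2.mono_of_mem_nhdsWithin ?_⟩
    filter_upwards [self_mem_nhdsWithin, mem_nhdsWithin_of_mem_nhds (Ioi_mem_nhds h)] with s hs hs'
    exact ⟨le_of_lt hs', hs.2⟩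

theorem IsSolutionOn.exists_glue {a b c : ℝ} {x z : ℝ → M}
    (hab : IsSolutionOn f D (Icc a b) x) (hbc : IsSolutionOn f D (Icc b c) z)
    (h1 : a ≤ b) (h2 : b ≤ c) (hxz : x b = z b) :
    ∃ w : ℝ → M, EqOn w x (Icc a b) ∧ EqOn w z (Icc b c) ∧ IsSolutionOn f D (Icc a c) w := by
  have e1 : EqOn (fun t => if t ≤ b then x t else z t) x (Icc a b) := fun t ht => if_pos ht.2
  have e2 : EqOn (fun t => if t ≤ b then x t else z t) z (Icc b c) := fun t ht => by
    rcases ht.1.eq_or_lt with rfl | h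
    · simpa using hxz
    · exact if_neg h.not_ge
  exact ⟨_, e1, e2, (hab.congr e1).union_Icc (hbc.congr e2) h1 h2⟩

/-- If a time-dependent family of sets `A s` is forward invariant, and solutions starting in it live
for a time `ε` that is uniform on bounded time intervals, then these solutions exist globally. -/
theorem exists_isSolution_of_uniform_time {t₀ : ℝ} {A : ℝ → Set M}
    (hloc : ∀ T, ∃ ε > 0, ∀ s ∈ Icc t₀ T, ∀ y ∈ A s,
      ∃ x : ℝ → M, x s = y ∧ IsSolutionOn f D (Icc s (s + ε)) x)
    (hinv : ∀ s s', t₀ ≤ s → s ≤ s' → ∀ x : ℝ → M, IsSolutionOn f D (Icc s s') x →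
      x s ∈ A s → x s' ∈ A s') {x₀ : M} (hx₀ : x₀ ∈ A t₀) :
    ∃ x, IsSolution f D t₀ x₀ x := by
  have hfin : ∀ T, ∀ s, t₀ ≤ s → s ≤ T → ∀ y ∈ A s,
      ∃ x : ℝ → M, x s = y ∧ IsSolutionOn f D (Icc s T) x := by
    intro T
    obtain ⟨ε, hε, hsol⟩ := hloc T
    have hN : ∀ N : ℕ, ∀ s, t₀ ≤ s → s ≤ T → T ≤ s + (N + 1) * ε → ∀ y ∈ A s,
        ∃ x : ℝ → M, x s = y ∧ IsSolutionOn f D (Icc s T) x := by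
      intro N
      induction N with
      | zero =>
        intro s hs hsT hT y hy
        obtain ⟨x, hx, hxs⟩ := hsol s ⟨hs, hsT⟩ y hy
        exact ⟨x, hx, hxs.mono (Icc_subset_Icc_right (by simpa using hT))⟩
      | succ N ih =>
        intro s hs hsT hT y hy
        obtain ⟨x, hx, hxs⟩ := hsol s ⟨hs, hsT⟩ y hy
        rcases le_or_gt T (s + ε) with hle | hlt
        · exact ⟨x, hx, hxs.mono (Icc_subset_Icc_right hle)⟩
        have hA := hinv s (s + ε) hs (by linarith) x hxs (by rwa [hx])
        push_cast at hT
        obtain ⟨z, hz, hzs⟩ := ih (s + ε) (by linarith) hlt.le (by linarith) _ hA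
        obtain ⟨w, hw, -, hws⟩ := hxs.exists_glue hzs (by linarith) hlt.le hz.symm
        exact ⟨w, by rw [hw ⟨le_rfl, by linarith⟩, hx], hws⟩
    intro s hs hsT
    obtain ⟨N, hN'⟩ := exists_nat_ge ((T - s) / ε)
    refine hN N s hs hsT ?_
    rw [div_le_iff₀ hε] at hN'
    linarith
  have hstep : ∀ (N : ℕ) (x : ℝ → M), (x t₀ = x₀ ∧ IsSolutionOn f D (Icc t₀ (t₀ + N)) x) →
      ∃ x' : ℝ → M, (x' t₀ = x₀ ∧ IsSolutionOn f D (Icc t₀ (t₀ + (N + 1 : ℕ))) x') ∧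
        EqOn x' x (Icc t₀ (t₀ + N)) := by
    rintro N x ⟨hx, hxs⟩
    have hN : (0 : ℝ) ≤ N := N.cast_nonneg
    have hA := hinv t₀ (t₀ + N) le_rfl (by linarith) x hxs (by rwa [hx])
    obtain ⟨z, hz, hzs⟩ := hfin (t₀ + (N + 1 : ℕ)) (t₀ + N) (by linarith)
      (by push_cast; linarith) _ hA
    obtain ⟨w, hw, -, hws⟩ := hxs.exists_glue hzs (by linarith) (by push_cast; linarith) hz.symm
    exact ⟨w, ⟨by rw [hw ⟨le_rfl, by linarith⟩, hx], hws⟩, hw⟩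
  obtain ⟨X₀, hX₀, hX₀s⟩ := hfin (t₀ + (0 : ℕ)) t₀ le_rfl (by simp) x₀ hx₀
  choose! next hnext heq using hstep
  let X : ℕ → ℝ → M := fun N => Nat.rec X₀ (fun N x => next N x) N
  have hX : ∀ N : ℕ, X N t₀ = x₀ ∧ IsSolutionOn f D (Icc t₀ (t₀ + N)) (X N) := by
    intro N
    induction N with
    | zero => exact ⟨hX₀, hX₀s⟩
    | succ N ih => exact hnext N (X N) ih
  have hXeq : ∀ m N : ℕ, m ≤ N → EqOn (X N) (X m) (Icc t₀ (t₀ + m)) := by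
    intro m N hmN
    induction N, hmN using Nat.le_induction with
    | base => exact fun _ _ => rfl
    | succ N hN ih =>
      intro t ht
      have hcast : (m : ℝ) ≤ N := by exact_mod_cast hN
      exact (heq N (X N) (hX N) ⟨ht.1, by linarith [ht.2]⟩).trans (ih ht)
  let x : ℝ → M := fun t => X (⌊t - t₀⌋₊ + 1) t
  have hx : ∀ N : ℕ, EqOn x (X N) (Icc t₀ (t₀ + N)) := by
    intro N t ht
    have hfl : t ∈ Icc t₀ (t₀ + (⌊t - t₀⌋₊ + 1 : ℕ)) :=
      ⟨ht.1, by push_cast; linarith [Nat.lt_floor_add_one (t - t₀)]⟩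
    rcases le_total N (⌊t - t₀⌋₊ + 1) with h | h
    · exact hXeq _ _ h ht
    · exact (hXeq _ _ h hfl).symm
  have hsol : ∀ N : ℕ, IsSolutionOn f D (Icc t₀ (t₀ + N)) x := fun N => (hX N).2.congr (hx N)
  refine ⟨x, ?_, fun t ht => ?_, fun t ht => ?_⟩
  · rw [hx 0 (by simp)]; exact (hX 0).1
  · obtain ⟨N, hN⟩ := exists_nat_ge (t - t₀)
    exact (hsol N t ⟨ht, by linarith⟩).1
  · obtain ⟨N, hN⟩ := exists_nat_gt (t - t₀)
    refine (hsol N t ⟨ht, by linarith⟩).2.mono_of_mem_nhdsWithin ?_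
    filter_upwards [self_mem_nhdsWithin,
      mem_nhdsWithin_of_mem_nhds (Iio_mem_nhds (show t < t₀ + N by linarith))] with s hs hs'
    exact ⟨hs, le_of_lt hs'⟩

theorem IsRegularField.exists_local_solution [IsManifold (𝓡 n) ∞ M] (hf : IsRegularField f D)
    (hD : IsOpen D) {t₁ : ℝ} (ht₁ : 0 ≤ t₁) {c : M} (hc : c ∈ D) :
    ∃ ε > 0, ∃ W ∈ 𝓝 c, ∀ s, 0 ≤ s → |s - t₁| < ε → ∀ y ∈ W,
      ∃ x : ℝ → M, x s = y ∧ IsSolutionOn f D (Icc s (s + ε)) x := by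
  obtain ⟨J, hJ, U, hU, K, hK⟩ := hf.locally_lipschitz t₁ ht₁ c hc
  set φ := extChartAt (𝓡 n) c with hφ
  have htarget : φ.target ∈ 𝓝 (φ c) := extChartAt_target_mem_nhds c
  have hpre : φ.symm ⁻¹' D ∈ 𝓝 (φ c) := by
    apply (continuousAt_extChartAt_symm c).preimage_mem_nhds
    rw [extChartAt_to_inv c]
    exact hD.mem_nhds hc
  obtain ⟨ρ, hρ, hball⟩ := Metric.nhds_basis_closedBall.mem_iff.1
    (Filter.inter_mem hU (Filter.inter_mem htarget hpre))
  obtain ⟨δ, hδ, hJδ⟩ := Metric.mem_nhdsWithin_iff.1 hJ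
  have hJ' : ∀ t, 0 ≤ t → |t - t₁| < δ → t ∈ J := fun t h0 h1 =>
    hJδ ⟨by rwa [Metric.mem_ball, Real.dist_eq], h0⟩
  have hcontF : ∀ u ∈ Metric.closedBall (φ c) ρ,
      ContinuousOn (fun t => chartField f c t u) (Ici 0) := fun u hu =>
    (mfderiv (𝓡 n) 𝓘(ℝ, EuclideanSpace ℝ (Fin n)) φ (φ.symm u)).continuous.comp_continuousOn
      (hf.continuous_time _ (hball hu).2.2)
  obtain ⟨C, hC⟩ := (isCompact_Icc (a := (0 : ℝ)) (b := t₁ + δ)).exists_bound_of_continuousOn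
    ((hcontF (φ c) (Metric.mem_closedBall_self hρ.le)).mono Icc_subset_Ici_self)
  set L : ℝ := |C| + K * ρ with hL
  have hL0 : 0 ≤ L := by positivity
  have hbound : ∀ t, 0 ≤ t → |t - t₁| < δ → ∀ u ∈ Metric.closedBall (φ c) ρ,
      ‖chartField f c t u‖ ≤ L := by
    intro t h0 h1 u hu
    have hl := (hK t (hJ' t h0 h1)).dist_le_mul u (hball hu).1 (φ c)
      (hball (Metric.mem_closedBall_self hρ.le)).1
    have hCt := hC t ⟨h0, by linarith [(abs_lt.1 h1).2]⟩
    rw [dist_eq_norm] at hl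
    have h2 : (K : ℝ) * dist u (φ c) ≤ K * ρ :=
      mul_le_mul_of_nonneg_left (Metric.mem_closedBall.1 hu) K.2
    have h3 := norm_le_norm_add_norm_sub' (chartField f c t u) (chartField f c t (φ c))
    linarith [le_abs_self C]
  set ε : ℝ := min (δ / 2) (ρ / (2 * (L + 1))) with hε
  have hε0 : 0 < ε := lt_min (by positivity) (by positivity)
  have hεδ : ε ≤ δ / 2 := min_le_left _ _
  have hεL : L * ε ≤ ρ / 2 := by
    have : ε * (2 * (L + 1)) ≤ ρ := (le_div_iff₀ (by positivity)).1 (min_le_right _ _)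
    nlinarith
  refine ⟨ε, hε0, φ.source ∩ φ ⁻¹' Metric.closedBall (φ c) (ρ / 2), ?_, ?_⟩
  · exact Filter.inter_mem (extChartAt_source_mem_nhds c)
      ((continuousAt_extChartAt c).preimage_mem_nhds (Metric.closedBall_mem_nhds _ (by positivity)))
  intro s hs hst y hy
  have htime : ∀ t ∈ Icc s (s + ε), 0 ≤ t ∧ |t - t₁| < δ := fun t ht =>
    ⟨hs.trans ht.1, abs_lt.2 ⟨by linarith [(abs_lt.1 hst).1, ht.1],
      by linarith [(abs_lt.1 hst).2, ht.2]⟩⟩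
  have hsub : Metric.closedBall (φ y) (ρ / 2) ⊆ Metric.closedBall (φ c) ρ := by
    apply Metric.closedBall_subset_closedBall'
    have := Metric.mem_closedBall.1 hy.2
    linarith
  have hPL : IsPicardLindelof (chartField f c) (tmin := s) (tmax := s + ε)
      ⟨s, le_rfl, by linarith⟩ (φ y) ⟨ρ / 2, by positivity⟩ 0 ⟨L, hL0⟩ K := by
    refine ⟨fun t ht => ?_, fun u hu => ?_, fun t ht u hu => ?_, ?_⟩
    · exact (hK t (hJ' t (htime t ht).1 (htime t ht).2)).mono
        fun u hu => (hball (hsub hu)).1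
    · exact (hcontF u (hsub hu)).mono fun t ht => (htime t ht).1
    · exact hbound t (htime t ht).1 (htime t ht).2 u (hsub hu)
    · have : L * max (s + ε - s) (s - s) ≤ ρ / 2 - 0 := by simpa [hε0.le] using hεL
      exact this
  obtain ⟨u, hu0, humem, hu⟩ := exists_forall_mem_Icc_hasDerivWithinAt_mem_closedBall hPL
  refine ⟨φ.symm ∘ u, ?_, fun t ht => ?_⟩
  · simp only [Function.comp_apply]
    rw [hu0, φ.left_inv hy.1]
  have hut := hball (hsub (humem t))
  refine ⟨hut.2.2, ?_⟩
  have hsymm := (mdifferentiableWithinAt_extChartAt_symm (I := 𝓡 n) hut.2.1).hasMFDerivWithinAt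
  have hcomp := hsymm.comp t (hu t ht).hasFDerivWithinAt.hasMFDerivWithinAt (by simp)
  refine hcomp.congr_mfderiv ?_
  have hinv := mfderivWithin_extChartAt_symm_comp_mfderiv_extChartAt (I := 𝓡 n) hut.2.1
  have happ := DFunLike.congr_fun hinv (f t (φ.symm (u t)))
  have key : ∀ (A : EuclideanSpace ℝ (Fin n) →L[ℝ] EuclideanSpace ℝ (Fin n))
      (v w : EuclideanSpace ℝ (Fin n)), A v = w →
      A.comp (ContinuousLinearMap.toSpanSingleton ℝ v) = (1 : ℝ →L[ℝ] ℝ).smulRight w := by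
    rintro A v w rfl
    ext
    simp
  exact key _ _ _ happ

theorem IsRegularField.exists_uniform_time [IsManifold (𝓡 n) ∞ M] (hf : IsRegularField f D)
    (hD : IsOpen D) {K : Set M} (hK : IsCompact K) (hKD : K ⊆ D) (T : ℝ) :
    ∃ ε > 0, ∀ s ∈ Icc 0 T, ∀ y ∈ K,
      ∃ x : ℝ → M, x s = y ∧ IsSolutionOn f D (Icc s (s + ε)) x := by
  suffices H : ∃ ε > 0, ∀ p ∈ Icc 0 T ×ˢ K,
      ∃ x : ℝ → M, x p.1 = p.2 ∧ IsSolutionOn f D (Icc p.1 (p.1 + ε)) x by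
    obtain ⟨ε, hε, H⟩ := H
    exact ⟨ε, hε, fun s hs y hy => H (s, y) ⟨hs, hy⟩⟩
  refine (isCompact_Icc.prod hK).induction_on (p := fun S => ∃ ε > 0, ∀ p ∈ S,
      ∃ x : ℝ → M, x p.1 = p.2 ∧ IsSolutionOn f D (Icc p.1 (p.1 + ε)) x)
    ⟨1, one_pos, by simp⟩ ?_ ?_ ?_
  · rintro S S' hSS ⟨ε, hε, h⟩
    exact ⟨ε, hε, fun p hp => h p (hSS hp)⟩
  · rintro S S' ⟨ε, hε, h⟩ ⟨ε', hε', h'⟩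
    refine ⟨min ε ε', lt_min hε hε', fun p hp => ?_⟩
    rcases hp with hp | hp
    · obtain ⟨x, hx, hxs⟩ := h p hp
      exact ⟨x, hx, hxs.mono (Icc_subset_Icc_right (by linarith [min_le_left ε ε']))⟩
    · obtain ⟨x, hx, hxs⟩ := h' p hp
      exact ⟨x, hx, hxs.mono (Icc_subset_Icc_right (by linarith [min_le_right ε ε']))⟩
  · rintro ⟨t₁, c⟩ ⟨ht₁, hc⟩
    obtain ⟨ε, hε, W, hW, h⟩ := hf.exists_local_solution hD ht₁.1 (hKD hc)
    refine ⟨(Icc 0 T ×ˢ K) ∩ (Metric.ball t₁ ε ×ˢ W), Filter.inter_mem self_mem_nhdsWithin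
      (mem_nhdsWithin_of_mem_nhds (prod_mem_nhds (Metric.ball_mem_nhds _ hε) hW)), ε, hε, ?_⟩
    rintro ⟨s, y⟩ ⟨⟨hs, -⟩, hs', hy⟩
    exact h s hs.1 (by simpa [Real.dist_eq] using hs') y hy

end Flow

section Lyapunov

variable {n : ℕ} {M : Type*} [MetricSpace M] [ChartedSpace (EuclideanSpace ℝ (Fin n)) M]
  {f : ℝ → (x : M) → TangentSpace (𝓡 n) x} {D : Set M} {V : ℝ → M → ℝ}

/-- The orbital derivative is the derivative of `V` along solutions. -/
theorem hasDerivWithinAt_comp_solution (hD : IsOpen D)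
    (hV : ContMDiffOn (𝓘(ℝ, ℝ).prod (𝓡 n)) 𝓘(ℝ, ℝ) 1
      (fun p : ℝ × M => V p.1 p.2) (Ici 0 ×ˢ D))
    {I : Set ℝ} (hI : I ⊆ Ici 0) {x : ℝ → M} (hx : IsSolutionOn f D I x) {t : ℝ} (ht : t ∈ I) :
    HasDerivWithinAt (fun s => V s (x s)) (orbitalDeriv f V t (x t)) I t := by
  have ht0 : (0 : ℝ) ≤ t := hI ht
  obtain ⟨hxD, hxd⟩ := hx t ht
  have hL := ((hV (t, x t) ⟨ht0, hxD⟩).mdifferentiableWithinAt one_ne_zero).hasMFDerivWithinAt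
  set L : ℝ × EuclideanSpace ℝ (Fin n) →L[ℝ] ℝ :=
    mfderivWithin (𝓘(ℝ, ℝ).prod (𝓡 n)) 𝓘(ℝ, ℝ) (fun p : ℝ × M => V p.1 p.2)
      (Ici 0 ×ˢ D) (t, x t) with hLdef
  have htime : derivWithin (fun s => V s (x t)) (Ici 0) t = L (1, 0) := by
    have h1 : HasMFDerivWithinAt 𝓘(ℝ, ℝ) (𝓘(ℝ, ℝ).prod (𝓡 n)) (fun s : ℝ => (s, x t)) (Ici 0) t _ :=
      (hasMFDerivWithinAt_id (I := 𝓘(ℝ, ℝ)) (Ici 0) t).prodMk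
        (hasMFDerivWithinAt_const (I := 𝓘(ℝ, ℝ)) (I' := 𝓡 n) (x t) (Ici 0) t)
    have h2 := hL.comp t h1 (show Ici 0 ⊆ (fun s => (s, x t)) ⁻¹' (Ici 0 ×ˢ D) from
      fun s hs => ⟨hs, hxD⟩)
    have h3 : HasFDerivWithinAt (fun s => V s (x t))
        (L.comp ((ContinuousLinearMap.id ℝ ℝ).prod 0)) (Ici 0) t :=
      hasMFDerivWithinAt_iff_hasFDerivWithinAt.1 h2
    exact h3.hasDerivWithinAt.derivWithin (uniqueDiffOn_Ici 0 t ht0)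
  have hspace : ∀ v : EuclideanSpace ℝ (Fin n),
      mfderiv (𝓡 n) 𝓘(ℝ, ℝ) (V t) (x t) v = L (0, v) := by
    intro v
    have h1 : HasMFDerivWithinAt (𝓡 n) (𝓘(ℝ, ℝ).prod (𝓡 n)) (fun y : M => (t, y)) D (x t) _ :=
      (hasMFDerivWithinAt_const (I := 𝓡 n) (I' := 𝓘(ℝ, ℝ)) t D (x t)).prodMk
        (hasMFDerivWithinAt_id (I := 𝓡 n) D (x t))
    have h2 := hL.comp (x t) h1 (show D ⊆ (fun y => (t, y)) ⁻¹' (Ici 0 ×ˢ D) from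
      fun s hs => ⟨ht0, hs⟩)
    have h3 := (h2.hasMFDerivAt (hD.mem_nhds hxD)).mfderiv
    exact DFunLike.congr_fun h3 v
  have h1 : HasMFDerivWithinAt 𝓘(ℝ, ℝ) (𝓘(ℝ, ℝ).prod (𝓡 n)) (fun s : ℝ => (s, x s)) I t _ :=
    (hasMFDerivWithinAt_id (I := 𝓘(ℝ, ℝ)) I t).prodMk hxd
  have h2 := hL.comp t h1 (show I ⊆ (fun s => (s, x s)) ⁻¹' (Ici 0 ×ˢ D) from
    fun s hs => ⟨hI hs, (hx s hs).1⟩)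
  have h3 : HasFDerivWithinAt (fun s => V s (x s))
      (L.comp ((ContinuousLinearMap.id ℝ ℝ).prod
        ((1 : ℝ →L[ℝ] ℝ).smulRight (show EuclideanSpace ℝ (Fin n) from f t (x t))))) I t :=
    hasMFDerivWithinAt_iff_hasFDerivWithinAt.1 h2
  refine h3.hasDerivWithinAt.congr_deriv ?_
  have hadd : ∀ v : EuclideanSpace ℝ (Fin n), L (1, v) = L (1, 0) + L (0, v) := fun v => by
    rw [← map_add]; simp
  have hsm : ∀ v : EuclideanSpace ℝ (Fin n), (1 : ℝ →L[ℝ] ℝ).smulRight v 1 = v := fun v => by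
    simp
  unfold orbitalDeriv
  rw [htime]
  refine Eq.trans ?_ ((hadd _).trans (congrArg (L (1, 0) + ·) (hspace (f t (x t))).symm))
  exact congrArg (fun v : EuclideanSpace ℝ (Fin n) => L (1, v)) (hsm _)

variable {xs : M} {k₁ k₂ k₃ a : ℝ}

theorem lyapunov_le_mul_exp (hD : IsOpen D) (hk₂ : 0 < k₂) (hk₃ : 0 < k₃)
    (hV : ContMDiffOn (𝓘(ℝ, ℝ).prod (𝓡 n)) 𝓘(ℝ, ℝ) 1
      (fun p : ℝ × M => V p.1 p.2) (Ici 0 ×ˢ D))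
    (hVle : ∀ t : ℝ, 0 ≤ t → ∀ x ∈ D, V t x ≤ k₂ * dist xs x ^ a)
    (hVdot : ∀ t : ℝ, 0 ≤ t → ∀ x ∈ D, orbitalDeriv f V t x ≤ -k₃ * dist xs x ^ a)
    {s T : ℝ} (hs : 0 ≤ s) (hsT : s ≤ T) {x : ℝ → M} (hx : IsSolutionOn f D (Icc s T) x) :
    V T (x T) ≤ V s (x s) * Real.exp (-(k₃ / k₂) * (T - s)) := by
  have hI : Icc s T ⊆ Ici 0 := fun t ht => hs.trans ht.1
  have hder : ∀ t ∈ Icc s T, HasDerivWithinAt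
      (fun t => V t (x t) * Real.exp (k₃ / k₂ * (t - s)))
      (orbitalDeriv f V t (x t) * Real.exp (k₃ / k₂ * (t - s)) +
        V t (x t) * (Real.exp (k₃ / k₂ * (t - s)) * (k₃ / k₂))) (Icc s T) t := by
    intro t ht
    have he : HasDerivAt (fun t => Real.exp (k₃ / k₂ * (t - s)))
        (Real.exp (k₃ / k₂ * (t - s)) * (k₃ / k₂)) t := by
      simpa using (((hasDerivAt_id t).sub_const s).const_mul (k₃ / k₂)).exp
    exact (hasDerivWithinAt_comp_solution hD hV hI hx ht).mul he.hasDerivWithinAt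
  have hanti := antitoneOn_of_hasDerivWithinAt_nonpos (convex_Icc s T)
    (fun t ht => (hder t ht).continuousWithinAt)
    (fun t ht => (hder t (interior_subset ht)).mono interior_subset) (fun t ht => by
      have ht' := interior_subset ht
      have h0 : 0 ≤ t := hI ht'
      have h1 := hVle t h0 _ (hx t ht').1
      have h2 := hVdot t h0 _ (hx t ht').1
      have h3 : k₃ / k₂ * V t (x t) ≤ k₃ * dist xs (x t) ^ a := by
        calc k₃ / k₂ * V t (x t) ≤ k₃ / k₂ * (k₂ * dist xs (x t) ^ a) := by gcongr
          _ = _ := by field_simp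
      have h4 := mul_nonpos_of_nonneg_of_nonpos (Real.exp_pos (k₃ / k₂ * (t - s))).le
        (show orbitalDeriv f V t (x t) + k₃ / k₂ * V t (x t) ≤ 0 by linarith)
      linarith)
  have h := hanti ⟨le_rfl, hsT⟩ ⟨hsT, le_rfl⟩ hsT
  simp only [sub_self, mul_zero, Real.exp_zero, mul_one] at h
  rw [neg_mul, Real.exp_neg, ← div_eq_mul_inv, le_div_iff₀ (Real.exp_pos _)]
  exact h

/-- The exponential estimate for the distance to the equilibrium. -/
theorem dist_le_of_isSolutionOn (hD : IsOpen D) (hk₁ : 0 < k₁) (hk₂ : 0 < k₂) (hk₃ : 0 < k₃)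
    (ha : 0 < a)
    (hV : ContMDiffOn (𝓘(ℝ, ℝ).prod (𝓡 n)) 𝓘(ℝ, ℝ) 1
      (fun p : ℝ × M => V p.1 p.2) (Ici 0 ×ˢ D))
    (hVbound : ∀ t : ℝ, 0 ≤ t → ∀ x ∈ D,
      k₁ * dist xs x ^ a ≤ V t x ∧ V t x ≤ k₂ * dist xs x ^ a)
    (hVdot : ∀ t : ℝ, 0 ≤ t → ∀ x ∈ D, orbitalDeriv f V t x ≤ -k₃ * dist xs x ^ a)
    {s T : ℝ} (hs : 0 ≤ s) (hsT : s ≤ T) {x : ℝ → M} (hx : IsSolutionOn f D (Icc s T) x) :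
    dist xs (x T) ≤
      (k₂ / k₁) ^ (1 / a) * dist xs (x s) * Real.exp (-(k₃ / (a * k₂)) * (T - s)) := by
  have h := lyapunov_le_mul_exp hD hk₂ hk₃ hV (fun t h0 y hy => (hVbound t h0 y hy).2) hVdot
    hs hsT hx
  have h1 := (hVbound T (hs.trans hsT) _ (hx T ⟨hsT, le_rfl⟩).1).1
  have h2 := (hVbound s hs _ (hx s ⟨le_rfl, hsT⟩).1).2
  have h3 : k₁ * dist xs (x T) ^ a ≤
      k₂ * dist xs (x s) ^ a * Real.exp (-(k₃ / k₂) * (T - s)) :=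
    h1.trans (h.trans (by gcongr))
  rw [← Real.rpow_le_rpow_iff dist_nonneg (by positivity) ha,
    Real.mul_rpow (by positivity) (Real.exp_pos _).le, Real.mul_rpow (by positivity) dist_nonneg,
    ← Real.rpow_mul (by positivity), one_div_mul_cancel ha.ne', Real.rpow_one, ← Real.exp_mul]
  have h4 : -(k₃ / (a * k₂)) * (T - s) * a = -(k₃ / k₂) * (T - s) := by field_simp
  rw [h4, div_mul_eq_mul_div, div_mul_eq_mul_div, le_div_iff₀ hk₁]
  linarith

theorem le_or_eq_univ_of_lyapunov_bounds [PreconnectedSpace M] (hD : IsOpen D) (hxs : xs ∈ D)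
    (hVbound : ∀ t : ℝ, 0 ≤ t → ∀ x ∈ D,
      k₁ * dist xs x ^ a ≤ V t x ∧ V t x ≤ k₂ * dist xs x ^ a) : k₁ ≤ k₂ ∨ D = univ := by
  by_cases h : ∃ y ∈ D, y ≠ xs
  · obtain ⟨y, hy, hne⟩ := h
    have hpos : 0 < dist xs y ^ a := Real.rpow_pos_of_pos (dist_pos.2 hne.symm) a
    have := (hVbound 0 le_rfl y hy).1.trans (hVbound 0 le_rfl y hy).2
    exact Or.inl (le_of_mul_le_mul_right this hpos)
  · push Not at h
    have hDs : D = {xs} := Subset.antisymm h (by simpa using hxs)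
    refine Or.inr (IsClopen.eq_univ ⟨?_, hD⟩ ⟨xs, hxs⟩)
    rw [hDs]
    exact isClosed_singleton

end Lyapunov

theorem closedBall_subset_of_lt_inradius {M : Type*} [MetricSpace M] {x : M} {D : Set M} {r : ℝ}
    (h : ENNReal.ofReal r < inradius x D) : Metric.closedBall x r ⊆ D := by
  obtain ⟨_, ⟨r', hr', rfl, hsub⟩, hlt⟩ := lt_sSup_iff.1 h
  exact (Metric.closedBall_subset_ball ((ENNReal.ofReal_lt_ofReal_iff hr').1 hlt)).trans hsub

end LyapunovManifold

theorem theorem2p2 {n : ℕ} {M : Type*} [MetricSpace M]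
    [ChartedSpace (EuclideanSpace ℝ (Fin n)) M] [IsManifold (𝓡 n) ∞ M]
    [RiemannianBundle (fun x : M => TangentSpace (𝓡 n) x)]
    [IsContMDiffRiemannianBundle (𝓡 n) ∞ (EuclideanSpace ℝ (Fin n))
      (fun x : M => TangentSpace (𝓡 n) x)]
    [IsRiemannianManifold (𝓡 n) M] [CompleteSpace M]
    (D : Set M) (hD : IsOpen D)
    (f : ℝ → (x : M) → TangentSpace (𝓡 n) x) (hf : LyapunovManifold.IsRegularField f D)
    (xs : M) (hxs : LyapunovManifold.IsEquilibrium f D xs)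
    (hDi : D ⊆ Metric.eball xs (LyapunovManifold.injectivityRadius n xs))
    (r₀ : ℝ≥0∞) (hr₀ : r₀ = LyapunovManifold.inradius xs D)
    (k₁ k₂ k₃ a : ℝ) (hk₁ : 0 < k₁) (hk₂ : 0 < k₂) (hk₃ : 0 < k₃) (ha : 0 < a)
    (V : ℝ → M → ℝ)
    (hV : ContMDiffOn (𝓘(ℝ, ℝ).prod (𝓡 n)) 𝓘(ℝ, ℝ) 1
      (fun p : ℝ × M => V p.1 p.2) (Ici 0 ×ˢ D))
    (hVbound : ∀ t : ℝ, 0 ≤ t → ∀ x ∈ D,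
      k₁ * dist xs x ^ a ≤ V t x ∧ V t x ≤ k₂ * dist xs x ^ a)
    (hVdot : ∀ t : ℝ, 0 ≤ t → ∀ x ∈ D,
      LyapunovManifold.orbitalDeriv f V t x ≤ -k₃ * dist xs x ^ a) :
    let B : Set M := Metric.eball xs (ENNReal.ofReal ((k₁ / k₂) ^ (1 / a)) * r₀)
    (r₀ = ⊤ → B = univ) ∧
    LyapunovManifold.IsExponentiallyStableIn f D xs B ∧
    ∀ t₀ : ℝ, 0 ≤ t₀ → ∀ x₀ ∈ B, ∀ x : ℝ → M, LyapunovManifold.IsSolution f D t₀ x₀ x →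
      ∀ t : ℝ, t₀ ≤ t →
        dist (x t) xs
          ≤ (k₂ / k₁) ^ (1 / a) * dist (x t₀) xs * Real.exp (-(k₃ / (a * k₂)) * (t - t₀)) := by
  open LyapunovManifold in
  intro B
  have : PreconnectedSpace M := preconnectedSpace_of_isRiemannianManifold n M
  have : ProperSpace M := properSpace_of_isRiemannianManifold n M
  have hc : 0 < (k₁ / k₂) ^ (1 / a) := by positivity
  have hdecay : ∀ t₀ : ℝ, 0 ≤ t₀ → ∀ x₀ : M, ∀ x : ℝ → M, IsSolution f D t₀ x₀ x →
      ∀ t : ℝ, t₀ ≤ t → dist xs (x t) ≤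
        (k₂ / k₁) ^ (1 / a) * dist xs (x t₀) * Real.exp (-(k₃ / (a * k₂)) * (t - t₀)) :=
    fun t₀ ht₀ x₀ x hx t ht => dist_le_of_isSolutionOn hD hk₁ hk₂ hk₃ ha hV hVbound hVdot ht₀ ht
      (hx.isSolutionOn.mono Icc_subset_Ici_self)
  have hlt : ∀ y ∈ B, ENNReal.ofReal ((k₂ / k₁) ^ (1 / a) * dist xs y) < inradius xs D := by
    intro y hy
    have hy' : ENNReal.ofReal (dist xs y) <
        ENNReal.ofReal ((k₁ / k₂) ^ (1 / a)) * inradius xs D := by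
      rw [← hr₀, ← edist_dist, edist_comm]
      exact hy
    have hinv : (k₂ / k₁) ^ (1 / a) = ((k₁ / k₂) ^ (1 / a))⁻¹ := by
      rw [← Real.inv_rpow (by positivity), inv_div]
    rw [hinv, ENNReal.ofReal_mul (by positivity), ENNReal.ofReal_inv_of_pos hc, mul_comm,
      ← div_eq_mul_inv]
    rw [mul_comm] at hy'
    exact ENNReal.div_lt_of_lt_mul hy'
  have hBD : B ⊆ D := by
    rcases le_or_eq_univ_of_lyapunov_bounds hD hxs.1 hVbound with hk | hu
    · intro y hy
      refine closedBall_subset_of_lt_inradius (hlt y hy) (Metric.mem_closedBall'.2 ?_)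
      refine le_mul_of_one_le_left dist_nonneg (Real.one_le_rpow ?_ (by positivity))
      rwa [one_le_div hk₁]
    · simp [hu]
  refine ⟨?_, ⟨hxs, hBD, (k₂ / k₁) ^ (1 / a), by positivity, k₃ / (a * k₂), by positivity,
    fun t₀ ht₀ x₀ hx₀ => ⟨?_, hdecay t₀ ht₀ x₀⟩⟩, ?_⟩
  · intro htop
    refine eq_univ_of_forall fun y => ?_
    simp only [B, htop, Metric.mem_eball]
    rw [ENNReal.mul_top (ENNReal.ofReal_pos.2 hc).ne']
    exact edist_lt_top y xs
  · set r : ℝ := (k₂ / k₁) ^ (1 / a) * dist xs x₀ with hr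
    have hKD : Metric.closedBall xs r ⊆ D := closedBall_subset_of_lt_inradius (hlt x₀ hx₀)
    have hAK : ∀ t, 0 ≤ t → ∀ y ∈ D, V t y ≤ k₂ * dist xs x₀ ^ a →
        y ∈ Metric.closedBall xs r := by
      intro t ht y hy hVy
      rw [Metric.mem_closedBall', ← Real.rpow_le_rpow_iff dist_nonneg (by positivity) ha, hr,
        Real.mul_rpow (by positivity) dist_nonneg, ← Real.rpow_mul (by positivity),
        one_div_mul_cancel ha.ne', Real.rpow_one, div_mul_eq_mul_div, le_div_iff₀ hk₁, mul_comm]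
      exact (hVbound t ht y hy).1.trans hVy
    refine exists_isSolution_of_uniform_time
      (A := fun t => {y | y ∈ D ∧ V t y ≤ k₂ * dist xs x₀ ^ a}) (fun T => ?_) ?_
      ⟨hBD hx₀, (hVbound t₀ ht₀ x₀ (hBD hx₀)).2⟩
    · obtain ⟨ε, hε, h⟩ := hf.exists_uniform_time hD (isCompact_closedBall xs r) hKD T
      exact ⟨ε, hε, fun s hs y hy =>
        h s ⟨ht₀.trans hs.1, hs.2⟩ y (hAK s (ht₀.trans hs.1) y hy.1 hy.2)⟩
    · intro s s' hs hss' x hx hxs'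
      refine ⟨(hx s' ⟨hss', le_rfl⟩).1, ?_⟩
      have hs0 : 0 ≤ s := ht₀.trans hs
      have h1 := lyapunov_le_mul_exp hD hk₂ hk₃ hV (fun t h0 y hy => (hVbound t h0 y hy).2) hVdot
        hs0 hss' hx
      have hVnn : 0 ≤ V s (x s) := le_trans (by positivity) (hVbound s hs0 _ hxs'.1).1
      have hexp : Real.exp (-(k₃ / k₂) * (s' - s)) ≤ 1 := by
        rw [Real.exp_le_one_iff, neg_mul, neg_nonpos]
        exact mul_nonneg (by positivity) (sub_nonneg.2 hss')
      exact h1.trans ((mul_le_of_le_one_right hVnn hexp).trans hxs'.2)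
  · intro t₀ ht₀ x₀ _ x hx t ht
    rw [dist_comm (x t), dist_comm (x t₀)]
    exact hdecay t₀ ht₀ x₀ x hx t ht
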